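/- All rings are commutative with identity and all modules are unital. A ring $R$ is coherent if every finitely generated ideal of $R$ is finitely presented. An $R$-module $G$ is Gorenstein projective if there is an exact complex $\mathbf{P}=\cdots\to P_{-1}\to P_0\to P_1\to\cdots$ of projective $R$-modules such that $\operatorname{Hom}_R(\mathbf{P},Q)$ is exact for every projective $R$-module $Q$ and $G\cong\operatorname{Im}(P_0\to P_1)$. For a nonzero $R$-module $M$, the Gorenstein projective dimension $\operatorname{Gpd}_R(M)\in\{0,1,2,\dots\}\cup\{\infty\}$ is the least $n\ge 0$ for which there is an exact sequence $0\to G_n\to\cdots\to G_0\to M\to 0$ with all $G_i$ Gorenstein projective, and $\infty$ if there is no such $n$; $\operatorname{pd}_R(M)$ denotes the projective dimension. Both dimensions of the zero module are $-\infty$. Let $\mathcal{F}(R)$ be the class of $R$-modules $M$ that admit a resolution $\cdots\to P_2\to P_1\to P_0\to M\to 0$, possibly of infinite length, with every $P_i$ a finitely generated projective $R$-module. Put $$\operatorname{fGPD}(R)=\sup\{\operatorname{Gpd}_R(M)\mid M\in\mathcal{F}(R),\ \operatorname{Gpd}_R(M)<\infty\},\qquad \operatorname{fPD}(R)=\sup\{\operatorname{pd}_R(M)\mid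 M\in\mathcal{F}(R),\ \operatorname{pd}_R(M)<\infty\}.$$ **Theorem.** For every coherent ring $R$, $\operatorname{fGPD}(R)=\operatorname{fPD}(R)$; in particular one side is infinite if and only if the other is. -/

import Mathlib

universe u

/-- A commutative ring is coherent if each of its finitely generated ideals is a finitely
presented module. -/
def IsCoherentRing (R : Type u) [CommRing R] : Prop :=
  ∀ I : Ideal R, I.FG → Module.FinitePresentation R I

/-- The sequence `⋯ ⟶ X 2 ⟶ X 1 ⟶ X 0 ⟶ M ⟶ 0`, with differentials `d i : X (i + 1) ⟶ X i` and
augmentation `ε : X 0 ⟶ M`, is exact. -/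
structure IsLeftResolution {R : Type u} [CommRing R] {M : ModuleCat.{u} R}
    {X : ℕ → ModuleCat.{u} R} (d : ∀ i : ℕ, X (i + 1) →ₗ[R] X i) (ε : X 0 →ₗ[R] M) : Prop where
  surjective : Function.Surjective ε
  exact_zero : Function.Exact (d 0) ε
  exact_succ : ∀ i : ℕ, Function.Exact (d (i + 1)) (d i)

/-- `M` admits a resolution `⋯ ⟶ P 1 ⟶ P 0 ⟶ M ⟶ 0`, possibly of infinite length, in which every
`P i` is a finitely generated projective module. -/
def HasFGProjectiveResolution {R : Type u} [CommRing R] (M : ModuleCat.{u} R) : Prop :=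
  ∃ (P : ℕ → ModuleCat.{u} R) (d : ∀ i : ℕ, P (i + 1) →ₗ[R] P i) (ε : P 0 →ₗ[R] M),
    IsLeftResolution d ε ∧ ∀ i : ℕ, Module.Projective R (P i) ∧ Module.Finite R (P i)

/-- `M` is Gorenstein projective: there is an exact complex
`⋯ ⟶ P (-1) ⟶ P 0 ⟶ P 1 ⟶ ⋯` of projective modules, indexed by `ℤ`, which stays exact under
`Hom(-, Q)` for every projective module `Q`, and `M` is isomorphic to the image of
`P 0 ⟶ P 1`. -/
def IsGorensteinProjective {R : Type u} [CommRing R] (M : ModuleCat.{u} R) : Prop :=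
  ∃ (P : ℤ → ModuleCat.{u} R) (d : ∀ i : ℤ, P i →ₗ[R] P (i + 1)),
    (∀ i : ℤ, Module.Projective R (P i)) ∧
    (∀ i : ℤ, Function.Exact (d i) (d (i + 1))) ∧
    (∀ Q : ModuleCat.{u} R, Module.Projective R Q → ∀ i : ℤ,
      Function.Exact (fun g : P (i + 1 + 1) →ₗ[R] Q => g ∘ₗ d (i + 1))
        (fun g : P (i + 1) →ₗ[R] Q => g ∘ₗ d i)) ∧
    Nonempty (M ≃ₗ[R] LinearMap.range (d 0))

/-- The Gorenstein projective dimension of `M` is `< n`: there is an exact sequence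
`0 ⟶ G (n - 1) ⟶ ⋯ ⟶ G 0 ⟶ M ⟶ 0` of modules with all `G i` Gorenstein projective
(for `n = 0` this says that `M` is zero). -/
def HasGorensteinProjectiveDimensionLT {R : Type u} [CommRing R] (M : ModuleCat.{u} R)
    (n : ℕ) : Prop :=
  ∃ (G : ℕ → ModuleCat.{u} R) (d : ∀ i : ℕ, G (i + 1) →ₗ[R] G i) (ε : G 0 →ₗ[R] M),
    IsLeftResolution d ε ∧ (∀ i : ℕ, IsGorensteinProjective (G i)) ∧
    ∀ i : ℕ, n ≤ i → Subsingleton (G i)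

/-- The Gorenstein projective dimension of `M`. As for Mathlib's `projectiveDimension`, it is `⊥`
for a zero module and `⊤` if there is no finite resolution by Gorenstein projectives. -/
noncomputable def gorensteinProjectiveDimension {R : Type u} [CommRing R]
    (M : ModuleCat.{u} R) : WithBot ℕ∞ :=
  sInf {n : WithBot ℕ∞ | ∀ i : ℕ, n < i → HasGorensteinProjectiveDimensionLT M i}

/-- The small finitistic projective dimension of `R`. -/
noncomputable def fPD (R : Type u) [CommRing R] : WithBot ℕ∞ :=
  sSup {n : WithBot ℕ∞ | ∃ M : ModuleCat.{u} R, HasFGProjectiveResolution M ∧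
    CategoryTheory.projectiveDimension M ≠ ⊤ ∧ n = CategoryTheory.projectiveDimension M}

/-- The small finitistic Gorenstein projective dimension of `R`. -/
noncomputable def fGPD (R : Type u) [CommRing R] : WithBot ℕ∞ :=
  sSup {n : WithBot ℕ∞ | ∃ M : ModuleCat.{u} R, HasFGProjectiveResolution M ∧
    gorensteinProjectiveDimension M ≠ ⊤ ∧ n = gorensteinProjectiveDimension M}

/-! If `projectiveDimension M` is finite, it equals the Gorenstein projective dimension, because a
Gorenstein projective module of finite projective dimension is projective. Hence `fPD R ≤ fGPD R`.

For the other inequality, a module `M` in F(R) of finite Gorenstein projective dimension is embedded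
in some `N` in F(R) of finite projective dimension, with Gorenstein projective cokernel. Bounds on
the Gorenstein projective dimension pass to kernels of epimorphisms onto Gorenstein projectives, so
Gpd M ≤ Gpd N = pd N ≤ fPD(R).

The embedding (`IsCoherentRing.exists_embedding_hasProjectiveDimensionLT`) comes by induction from
the case of a Gorenstein projective `G` (`IsCoherentRing.exists_coresolution`), where coherence
enters. The dual of `G` is finitely generated, and its generators assemble to a map from `G` to a
finite free module through which every functional, hence every map to a projective, factors. As `G`
embeds in some projective, this map is injective, and its cokernel is again Gorenstein projective.

Gorenstein projectivity is treated coinductively: `IsGProj` is membership in a class closed under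
one step to the left and one to the right. Closure properties then follow by exhibiting a suitable
larger class, and the complexes indexed by `ℤ` appear only in the comparison with the original
definition. -/

open Function

/-! ### Short exact sequences: splitting, pullbacks, pushouts, horseshoes -/

section ShortExact

variable {R : Type u} [CommRing R]

/-- `0 ⟶ A ⟶ B ⟶ C ⟶ 0` is a short exact sequence of modules. -/
structure IsSES {A B C : Type u} [AddCommGroup A] [Module R A] [AddCommGroup B] [Module R B]
    [AddCommGroup C] [Module R C] (f : A →ₗ[R] B) (g : B →ₗ[R] C) : Prop where
  inj : Injective f
  exact : Exact f g
  surj : Surjective g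

variable {A B C D P K Q X Y Z : Type u}
  [AddCommGroup A] [Module R A] [AddCommGroup B] [Module R B] [AddCommGroup C] [Module R C]
  [AddCommGroup D] [Module R D] [AddCommGroup P] [Module R P] [AddCommGroup K] [Module R K]
  [AddCommGroup Q] [Module R Q] [AddCommGroup X] [Module R X] [AddCommGroup Y] [Module R Y]
  [AddCommGroup Z] [Module R Z]

theorem LinearMap.exists_comp_eq_of_injective {i : X →ₗ[R] Y} (hi : Injective i) {q : Z →ₗ[R] Y}
    (h : ∀ z, ∃ x, i x = q z) : ∃ r : Z →ₗ[R] X, i ∘ₗ r = q := by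
  refine ⟨(LinearEquiv.ofInjective i hi).symm.toLinearMap ∘ₗ q.codRestrict (LinearMap.range i) h,
    ?_⟩
  ext z
  have := LinearEquiv.apply_symm_apply (LinearEquiv.ofInjective i hi)
    (q.codRestrict (LinearMap.range i) h z)
  exact congrArg Subtype.val this

theorem LinearMap.exists_comp_eq_of_surjective {p : X →ₗ[R] Y} (hp : Surjective p)
    {q : X →ₗ[R] Z} (h : ∀ x, p x = 0 → q x = 0) : ∃ r : Y →ₗ[R] Z, r ∘ₗ p = q := by
  refine ⟨(LinearMap.ker p).liftQ q h ∘ₗ (p.quotKerEquivOfSurjective hp).symm.toLinearMap, ?_⟩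
  refine LinearMap.ext fun x => ?_
  have : (p.quotKerEquivOfSurjective hp).symm (p x) = Submodule.Quotient.mk x := by
    rw [LinearEquiv.symm_apply_eq]; rfl
  exact congrArg ((LinearMap.ker p).liftQ q h) this

theorem IsSES.comp_apply {f : A →ₗ[R] B} {g : B →ₗ[R] C} (h : IsSES f g) (a : A) :
    g (f a) = 0 := (h.exact _).2 ⟨a, rfl⟩

theorem IsSES.exists_eq {f : A →ₗ[R] B} {g : B →ₗ[R] C} (h : IsSES f g) {b : B} (hb : g b = 0) :
    ∃ a, f a = b := (h.exact _).1 hb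

theorem isSES_mk' {f : A →ₗ[R] B} {g : B →ₗ[R] C} (hf : ∀ a, f a = 0 → a = 0)
    (hfg : ∀ a, g (f a) = 0) (h : ∀ b, g b = 0 → ∃ a, f a = b) (hg : Surjective g) : IsSES f g :=
  ⟨(injective_iff_map_eq_zero f).2 hf,
    fun b => ⟨h b, fun ⟨a, ha⟩ => ha ▸ hfg a⟩, hg⟩

theorem IsSES.eq_zero {f : A →ₗ[R] B} {g : B →ₗ[R] C} (h : IsSES f g) {a : A} (ha : f a = 0) :
    a = 0 := (injective_iff_map_eq_zero f).1 h.inj a ha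

theorem isSES_ker {g : B →ₗ[R] C} (hg : Surjective g) : IsSES (LinearMap.ker g).subtype g :=
  isSES_mk' (fun a ha => by simpa using ha) (fun a => a.2) (fun b hb => ⟨⟨b, hb⟩, rfl⟩) hg

theorem isSES_coker {f : A →ₗ[R] B} (hf : Injective f) :
    IsSES f (LinearMap.range f).mkQ :=
  isSES_mk' (fun _ ha => (injective_iff_map_eq_zero f).1 hf _ ha)
    (fun a => by simp) (fun b hb => by simpa using hb) (Submodule.mkQ_surjective _)

theorem isSES_inl_snd : IsSES (LinearMap.inl R A B) (LinearMap.snd R A B) :=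
  isSES_mk' (fun a ha => by simpa using ha) (fun a => by simp)
    (fun b hb => ⟨b.1, by ext <;> simp_all⟩) (fun b => ⟨(0, b), rfl⟩)

theorem isSES_equiv_zero (e : A ≃ₗ[R] B) : IsSES e.toLinearMap (0 : B →ₗ[R] PUnit.{u + 1}) :=
  isSES_mk' (fun a ha => by simpa using ha) (fun a => by simp)
    (fun b _ => ⟨e.symm b, by simp⟩) (fun b => ⟨0, by simp⟩)

theorem isSES_zero_equiv (e : A ≃ₗ[R] B) : IsSES (0 : PUnit.{u + 1} →ₗ[R] A) e.toLinearMap :=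
  isSES_mk' (fun a _ => Subsingleton.elim _ _) (fun a => by simp)
    (fun b hb => ⟨0, by simpa using (e.map_eq_zero_iff.1 hb).symm⟩) e.surjective

/-- A retraction of the first map of a short exact sequence gives the reversed sequence. -/
theorem IsSES.exists_reverse {f : A →ₗ[R] B} {g : B →ₗ[R] C} (h : IsSES f g) {r : B →ₗ[R] A}
    (hr : r ∘ₗ f = LinearMap.id) : ∃ s : C →ₗ[R] B, g ∘ₗ s = LinearMap.id ∧ IsSES s r := by
  have hr' (a : A) : r (f a) = a := LinearMap.congr_fun hr a
  obtain ⟨s, hs⟩ := LinearMap.exists_comp_eq_of_surjective h.surj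
    (q := LinearMap.id - f ∘ₗ r) (fun x hx => by
      obtain ⟨a, rfl⟩ := h.exists_eq hx
      simp [hr'])
  have hs' (b : B) : s (g b) = b - f (r b) := LinearMap.congr_fun hs b
  have hgs (c : C) : g (s c) = c := by
    obtain ⟨b, rfl⟩ := h.surj c
    rw [hs', map_sub, h.comp_apply, sub_zero]
  refine ⟨s, LinearMap.ext hgs, isSES_mk' (fun c hc => ?_) (fun c => ?_) (fun b hb => ?_)
    (fun a => ⟨f a, hr' a⟩)⟩
  · rw [← hgs c, hc, map_zero]
  · obtain ⟨b, rfl⟩ := h.surj c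
    rw [hs', map_sub, hr', sub_self]
  · exact ⟨g b, by rw [hs', hb]; simp⟩

theorem IsSES.exists_section {f : A →ₗ[R] B} {g : B →ₗ[R] C} (h : IsSES f g)
    [Module.Projective R C] : ∃ s : C →ₗ[R] B, g ∘ₗ s = LinearMap.id :=
  Module.projective_lifting_property g LinearMap.id h.surj

theorem IsSES.exists_retraction {f : A →ₗ[R] B} {g : B →ₗ[R] C} (h : IsSES f g) {s : C →ₗ[R] B}
    (hs : g ∘ₗ s = LinearMap.id) : ∃ r : B →ₗ[R] A, r ∘ₗ f = LinearMap.id := by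
  have hs' (c : C) : g (s c) = c := LinearMap.congr_fun hs c
  obtain ⟨r, hr⟩ := LinearMap.exists_comp_eq_of_injective h.inj
    (q := LinearMap.id - s ∘ₗ g) (fun z => h.exists_eq (by simp [hs']))
  have hr' (b : B) : f (r b) = b - s (g b) := LinearMap.congr_fun hr b
  exact ⟨r, LinearMap.ext fun a => h.inj (by simp [hr', h.comp_apply])⟩

/-- The two short exact sequences through a pullback of epimorphisms. -/
theorem IsSES.exists_pullback {f : A →ₗ[R] B} {g : B →ₗ[R] C} (h : IsSES f g)
    {f' : K →ₗ[R] P} {g' : P →ₗ[R] C} (h' : IsSES f' g') :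
    ∃ (X : ModuleCat.{u} R) (i : A →ₗ[R] X) (j : X →ₗ[R] P) (i' : K →ₗ[R] X) (j' : X →ₗ[R] B),
      IsSES i j ∧ IsSES i' j' := by
  let W : Submodule R (B × P) := LinearMap.eqLocus (g ∘ₗ LinearMap.fst R B P)
    (g' ∘ₗ LinearMap.snd R B P)
  refine ⟨ModuleCat.of R W,
    (LinearMap.inl R B P ∘ₗ f).codRestrict W (fun a => by simp [W, h.comp_apply]),
    LinearMap.snd R B P ∘ₗ W.subtype,
    (LinearMap.inr R B P ∘ₗ f').codRestrict W (fun a => by simp [W, h'.comp_apply]),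
    LinearMap.fst R B P ∘ₗ W.subtype, isSES_mk' ?_ ?_ ?_ ?_, isSES_mk' ?_ ?_ ?_ ?_⟩
  · intro a ha
    exact h.eq_zero (congrArg (fun w : W => w.1.1) ha)
  · intro a; rfl
  · rintro ⟨⟨b, p⟩, hw : g b = g' p⟩ (rfl : p = 0)
    obtain ⟨a, rfl⟩ := h.exists_eq (by simpa using hw)
    exact ⟨a, rfl⟩
  · intro p
    obtain ⟨b, hb⟩ := h.surj (g' p)
    exact ⟨⟨(b, p), hb⟩, rfl⟩
  · intro a ha
    exact h'.eq_zero (congrArg (fun w : W => w.1.2) ha)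
  · intro a; rfl
  · rintro ⟨⟨b, p⟩, hw : g b = g' p⟩ (rfl : b = 0)
    obtain ⟨a, rfl⟩ := h'.exists_eq (b := p) (by simpa using hw.symm)
    exact ⟨a, rfl⟩
  · intro b
    obtain ⟨p, hp⟩ := h'.surj (g b)
    exact ⟨⟨(b, p), hp.symm⟩, rfl⟩

/-- The two short exact sequences through a pushout of monomorphisms. -/
theorem IsSES.exists_pushout {f : A →ₗ[R] B} {g : B →ₗ[R] C} (h : IsSES f g)
    {f' : A →ₗ[R] P} {g' : P →ₗ[R] D} (h' : IsSES f' g') :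
    ∃ (X : ModuleCat.{u} R) (i : B →ₗ[R] X) (j : X →ₗ[R] D) (i' : P →ₗ[R] X) (j' : X →ₗ[R] C),
      IsSES i j ∧ IsSES i' j' := by
  let W : Submodule R (B × P) := LinearMap.range (f.prod (-f'))
  have hW (b : B) (p : P) : W.mkQ (b, p) = 0 ↔ ∃ a, f a = b ∧ - f' a = p := by
    simp [W, Submodule.Quotient.mk_eq_zero, Prod.ext_iff]
  refine ⟨ModuleCat.of R ((B × P) ⧸ W),
    W.mkQ ∘ₗ LinearMap.inl R B P,
    W.liftQ (g' ∘ₗ LinearMap.snd R B P) (by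
      rintro _ ⟨a, rfl⟩
      simp [h'.comp_apply]),
    W.mkQ ∘ₗ LinearMap.inr R B P,
    W.liftQ (g ∘ₗ LinearMap.fst R B P) (by
      rintro _ ⟨a, rfl⟩
      simp [h.comp_apply]), isSES_mk' ?_ ?_ ?_ ?_, isSES_mk' ?_ ?_ ?_ ?_⟩
  · intro b hb
    obtain ⟨a, rfl, ha⟩ := (hW b 0).1 hb
    rw [h'.eq_zero (neg_eq_zero.1 ha), map_zero]
  · intro b; simp
  · intro x hx
    obtain ⟨⟨b, p⟩, rfl⟩ := W.mkQ_surjective x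
    obtain ⟨a, rfl⟩ := h'.exists_eq (b := p) (by simpa using hx)
    refine ⟨b + f a, sub_eq_zero.1 ?_⟩
    rw [LinearMap.comp_apply, ← map_sub]
    exact (hW _ _).2 ⟨a, by simp, by simp⟩
  · intro d
    obtain ⟨p, rfl⟩ := h'.surj d
    exact ⟨W.mkQ (0, p), by simp⟩
  · intro p hp
    obtain ⟨a, ha, rfl⟩ := (hW 0 p).1 hp
    rw [h.eq_zero ha, map_zero, neg_zero]
  · intro b; simp
  · intro x hx
    obtain ⟨⟨b, p⟩, rfl⟩ := W.mkQ_surjective x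
    obtain ⟨a, rfl⟩ := h.exists_eq (b := b) (by simpa using hx)
    refine ⟨p + f' a, sub_eq_zero.1 ?_⟩
    rw [LinearMap.comp_apply, ← map_sub]
    exact (hW _ _).2 ⟨-a, by simp, by simp⟩
  · intro c
    obtain ⟨b, rfl⟩ := h.surj c
    exact ⟨W.mkQ (b, 0), by simp⟩

/-- The kernel of a composition of epimorphisms. -/
theorem IsSES.exists_ker_comp {f : K →ₗ[R] B} {g : B →ₗ[R] X} (h : IsSES f g)
    {f' : A →ₗ[R] X} {g' : X →ₗ[R] C} (h' : IsSES f' g') :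
    ∃ (H : ModuleCat.{u} R) (i : H →ₗ[R] B) (j : K →ₗ[R] H) (k : H →ₗ[R] A),
      IsSES i (g' ∘ₗ g) ∧ IsSES j k ∧ i ∘ₗ j = f := by
  let W : Submodule R B := LinearMap.ker (g' ∘ₗ g)
  obtain ⟨k, hk⟩ := LinearMap.exists_comp_eq_of_injective h'.inj (q := g ∘ₗ W.subtype)
    (fun w => h'.exists_eq w.2)
  have hk' (w : W) : f' (k w) = g w := LinearMap.congr_fun hk w
  refine ⟨ModuleCat.of R W, W.subtype, f.codRestrict W (fun x => by simp [W, h.comp_apply]), k,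
    isSES_ker (h'.surj.comp h.surj), isSES_mk' ?_ ?_ ?_ ?_, rfl⟩
  · intro x hx
    exact h.eq_zero (congrArg Subtype.val hx)
  · intro x
    refine h'.inj ((hk' _).trans ?_)
    exact (h.comp_apply x).trans (map_zero f').symm
  · intro w hw
    obtain ⟨x, hx⟩ := h.exists_eq (b := w.1) (by rw [← hk' w, hw, map_zero])
    exact ⟨x, Subtype.ext hx⟩
  · intro a
    obtain ⟨b, hb⟩ := h.surj (f' a)
    refine ⟨⟨b, ?_⟩, h'.inj ?_⟩
    · simp [W, hb, h'.comp_apply]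
    · rw [hk']; exact hb

/-- The cokernel of a composition of monomorphisms. -/
theorem IsSES.exists_coker_comp {f : A →ₗ[R] B} {g : B →ₗ[R] C} (h : IsSES f g)
    {f' : B →ₗ[R] P} {g' : P →ₗ[R] D} (h' : IsSES f' g') :
    ∃ (N : ModuleCat.{u} R) (p : P →ₗ[R] N) (i : C →ₗ[R] N) (j : N →ₗ[R] D),
      IsSES (f' ∘ₗ f) p ∧ IsSES i j := by
  let W : Submodule R P := LinearMap.range (f' ∘ₗ f)
  have hW (x : P) : W.mkQ x = 0 ↔ ∃ a, f' (f a) = x := by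
    simp [W, Submodule.Quotient.mk_eq_zero]
  obtain ⟨i, hi⟩ := LinearMap.exists_comp_eq_of_surjective h.surj (q := W.mkQ ∘ₗ f')
    (fun b hb => by
      obtain ⟨a, rfl⟩ := h.exists_eq hb
      exact (hW _).2 ⟨a, rfl⟩)
  have hi' (b : B) : i (g b) = W.mkQ (f' b) := LinearMap.congr_fun hi b
  refine ⟨ModuleCat.of R (P ⧸ W), W.mkQ, i, W.liftQ g' (by
    rintro _ ⟨a, rfl⟩
    exact h'.comp_apply _), isSES_coker (h'.inj.comp h.inj), isSES_mk' ?_ ?_ ?_ ?_⟩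
  · intro c hc
    obtain ⟨b, rfl⟩ := h.surj c
    rw [hi'] at hc
    obtain ⟨a, ha⟩ := (hW _).1 hc
    rw [← h'.inj ha, h.comp_apply]
  · intro c
    obtain ⟨b, rfl⟩ := h.surj c
    rw [hi']
    exact h'.comp_apply b
  · intro x hx
    obtain ⟨x, rfl⟩ := W.mkQ_surjective x
    obtain ⟨b, rfl⟩ := h'.exists_eq (b := x) hx
    exact ⟨g b, hi' b⟩
  · intro d
    obtain ⟨x, rfl⟩ := h'.surj d
    exact ⟨W.mkQ x, rfl⟩

/-- The horseshoe lemma for embeddings. -/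
theorem IsSES.exists_horseshoe_right {f : A →ₗ[R] B} {g : B →ₗ[R] C} (h : IsSES f g)
    {a : A →ₗ[R] P} {a' : P →ₗ[R] X} (ha : IsSES a a')
    {c : C →ₗ[R] Q} {c' : Q →ₗ[R] Y} (hc : IsSES c c')
    {β : B →ₗ[R] P} (hβ : β ∘ₗ f = a) :
    ∃ (Z : ModuleCat.{u} R) (b : B →ₗ[R] (P × Q)) (b' : (P × Q) →ₗ[R] Z) (i : X →ₗ[R] Z)
      (j : Z →ₗ[R] Y), IsSES b b' ∧ IsSES i j := by
  have hβ' (x : A) : β (f x) = a x := LinearMap.congr_fun hβ x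
  let φ : B →ₗ[R] (P × Q) := β.prod (c ∘ₗ g)
  have hφ : Injective φ := (injective_iff_map_eq_zero φ).2 fun b hb => by
    have h1 : β b = 0 := congrArg Prod.fst hb
    have h2 : c (g b) = 0 := congrArg Prod.snd hb
    obtain ⟨x, rfl⟩ := h.exists_eq (hc.eq_zero h2)
    rw [ha.eq_zero (a := x) (by rw [← hβ', h1]), map_zero]
  let W : Submodule R (P × Q) := LinearMap.range φ
  have hW (p : P) (q : Q) : W.mkQ (p, q) = 0 ↔ ∃ b, β b = p ∧ c (g b) = q := by
    simp [W, φ, Submodule.Quotient.mk_eq_zero, Prod.ext_iff]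
  obtain ⟨i, hi⟩ := LinearMap.exists_comp_eq_of_surjective ha.surj
    (q := W.mkQ ∘ₗ LinearMap.inl R P Q) (fun p hp => by
      obtain ⟨x, rfl⟩ := ha.exists_eq hp
      exact (hW _ _).2 ⟨f x, hβ' x, (congrArg c (h.comp_apply x)).trans (map_zero c)⟩)
  have hi' (p : P) : i (a' p) = W.mkQ (p, 0) := LinearMap.congr_fun hi p
  refine ⟨ModuleCat.of R ((P × Q) ⧸ W), φ, W.mkQ, i, W.liftQ (c' ∘ₗ LinearMap.snd R P Q) (by
    rintro _ ⟨a, rfl⟩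
    exact hc.comp_apply _), isSES_coker hφ, isSES_mk' ?_ ?_ ?_ ?_⟩
  · intro x hx
    obtain ⟨p, rfl⟩ := ha.surj x
    rw [hi'] at hx
    obtain ⟨b, rfl, hb⟩ := (hW _ _).1 hx
    obtain ⟨x, rfl⟩ := h.exists_eq (hc.eq_zero hb)
    rw [hβ', ha.comp_apply]
  · intro x
    obtain ⟨p, rfl⟩ := ha.surj x
    rw [hi']
    exact map_zero c'
  · intro z hz
    obtain ⟨⟨p, q⟩, rfl⟩ := W.mkQ_surjective z
    obtain ⟨y, rfl⟩ := hc.exists_eq (b := q) hz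
    obtain ⟨b, rfl⟩ := h.surj y
    refine ⟨a' (p - β b), ?_⟩
    rw [hi', ← sub_eq_zero, ← map_sub]
    exact (hW _ _).2 ⟨-b, by simp, by simp⟩
  · intro y
    obtain ⟨q, rfl⟩ := hc.surj y
    exact ⟨W.mkQ (0, q), rfl⟩

/-- The horseshoe lemma for presentations. -/
theorem IsSES.exists_horseshoe_left {f : A →ₗ[R] B} {g : B →ₗ[R] C} (h : IsSES f g)
    {a : X →ₗ[R] P} {a' : P →ₗ[R] A} (ha : IsSES a a')
    {c : Y →ₗ[R] Q} {c' : Q →ₗ[R] C} (hc : IsSES c c') [Module.Projective R Q] :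
    ∃ (Z : ModuleCat.{u} R) (b : Z →ₗ[R] (P × Q)) (b' : (P × Q) →ₗ[R] B) (i : X →ₗ[R] Z)
      (j : Z →ₗ[R] Y), IsSES b b' ∧ IsSES i j := by
  obtain ⟨γ, hγ⟩ := Module.projective_lifting_property g c' h.surj
  have hγ' (q : Q) : g (γ q) = c' q := LinearMap.congr_fun hγ q
  let ψ : (P × Q) →ₗ[R] B := (f ∘ₗ a').coprod γ
  have hψ : Surjective ψ := fun b => by
    obtain ⟨q, hq⟩ := hc.surj (g b)
    obtain ⟨x, hx⟩ := h.exists_eq (b := b - γ q) (by rw [map_sub, hγ', hq, sub_self])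
    obtain ⟨p, rfl⟩ := ha.surj x
    exact ⟨(p, q), by simp [ψ, hx]⟩
  let W : Submodule R (P × Q) := LinearMap.ker ψ
  have hW (w : W) : f (a' w.1.1) + γ w.1.2 = 0 := w.2
  obtain ⟨j, hj⟩ := LinearMap.exists_comp_eq_of_injective hc.inj
    (q := LinearMap.snd R P Q ∘ₗ W.subtype) (fun w => hc.exists_eq (by
      have := congrArg g (hW w)
      simpa [h.comp_apply, hγ'] using this))
  have hj' (w : W) : c (j w) = w.1.2 := LinearMap.congr_fun hj w
  refine ⟨ModuleCat.of R W, W.subtype, ψ, (LinearMap.inl R P Q ∘ₗ a).codRestrict W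
    (fun x => by simp [W, ψ, ha.comp_apply]), j, isSES_ker hψ, isSES_mk' ?_ ?_ ?_ ?_⟩
  · intro x hx
    exact ha.eq_zero (congrArg (fun w : W => w.1.1) hx)
  · intro x
    exact hc.inj ((hj' _).trans (map_zero c).symm)
  · rintro ⟨⟨p, q⟩, hw⟩ hpq
    have hq : q = 0 := (hj' ⟨(p, q), hw⟩).symm.trans ((congrArg c hpq).trans (map_zero c))
    subst hq
    have := hW ⟨⟨p, 0⟩, hw⟩
    obtain ⟨x, rfl⟩ := ha.exists_eq (b := p) (h.eq_zero (by simpa using this))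
    exact ⟨x, rfl⟩
  · intro y
    obtain ⟨x, hx⟩ := h.exists_eq (b := γ (c y)) (by rw [hγ', hc.comp_apply])
    obtain ⟨p, rfl⟩ := ha.surj x
    refine ⟨⟨(-p, c y), by simp [W, ψ, hx]⟩, hc.inj ?_⟩
    rw [hj']

theorem exists_projective_presentation (R : Type u) [CommRing R] (M : Type u) [AddCommGroup M]
    [Module R M] : ∃ (K P : ModuleCat.{u} R) (f : K →ₗ[R] P) (g : P →ₗ[R] M),
      Module.Projective R P ∧ IsSES f g :=
  ⟨ModuleCat.of R (LinearMap.ker (Finsupp.linearCombination R (id : M → M))),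
    ModuleCat.of R (M →₀ R), _, Finsupp.linearCombination R id,
    inferInstanceAs (Module.Projective R (M →₀ R)),
    isSES_ker (Finsupp.linearCombination_id_surjective R M)⟩

end ShortExact

/-! ### Gorenstein projective modules, coinductively -/

section GorensteinProjective

variable {R : Type u} [CommRing R]

variable (R) in
/-- The vanishing of `Ext¹(C, Q)` for all projective modules `Q`, phrased as the extension of
homomorphisms into `Q` along monomorphisms with cokernel `C`. -/
def ExtProjVanish (C : Type u) [AddCommGroup C] [Module R C] : Prop :=
  ∀ (Q A B : ModuleCat.{u} R) (f : A →ₗ[R] B) (g : B →ₗ[R] C), Module.Projective R Q →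
    IsSES f g → ∀ h : A →ₗ[R] Q, ∃ h' : B →ₗ[R] Q, h' ∘ₗ f = h

/-- A class of modules with vanishing `Ext¹` into projectives in which every member is both a
syzygy and a cosyzygy of a member. -/
def IsGProjClass (S : ModuleCat.{u} R → Prop) : Prop :=
  ∀ X : ModuleCat.{u} R, S X → ExtProjVanish R X ∧
    (∃ (K P : ModuleCat.{u} R) (f : K →ₗ[R] P) (g : P →ₗ[R] X),
      Module.Projective R P ∧ IsSES f g ∧ S K) ∧
    (∃ (P D : ModuleCat.{u} R) (f : X →ₗ[R] P) (g : P →ₗ[R] D),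
      Module.Projective R P ∧ IsSES f g ∧ S D)

variable (R) in
/-- Membership in the largest class satisfying `IsGProjClass`. -/
def IsGProj (C : Type u) [AddCommGroup C] [Module R C] : Prop :=
  ∃ S : ModuleCat.{u} R → Prop, IsGProjClass S ∧ S (ModuleCat.of R C)

variable {A B C D P K Q X Y Z : Type u}
  [AddCommGroup A] [Module R A] [AddCommGroup B] [Module R B] [AddCommGroup C] [Module R C]
  [AddCommGroup D] [Module R D] [AddCommGroup P] [Module R P] [AddCommGroup K] [Module R K]
  [AddCommGroup Q] [Module R Q] [AddCommGroup X] [Module R X] [AddCommGroup Y] [Module R Y]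
  [AddCommGroup Z] [Module R Z]

theorem ExtProjVanish.exists_extension (hC : ExtProjVanish R C) {f : A →ₗ[R] B} {g : B →ₗ[R] C}
    (h : IsSES f g) [hQ : Module.Projective R Q] (q : A →ₗ[R] Q) :
    ∃ q' : B →ₗ[R] Q, q' ∘ₗ f = q :=
  hC (ModuleCat.of R Q) (ModuleCat.of R A) (ModuleCat.of R B) f g hQ h q

/-- Ext¹ can be tested on a single projective presentation. Any other extension `B'` of `C` by `A'`
is a quotient of `A' × P`, and `q` on `A'` together with an extension of `q ∘ₗ t` to `P` kills the
kernel. -/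
theorem ExtProjVanish.of_projective_middle {f : A →ₗ[R] P} {g : P →ₗ[R] C} (h : IsSES f g)
    [Module.Projective R P]
    (hext : ∀ Q : ModuleCat.{u} R, Module.Projective R Q → ∀ q : A →ₗ[R] Q,
      ∃ q' : P →ₗ[R] Q, q' ∘ₗ f = q) : ExtProjVanish R C := by
  intro Q A' B' f' g' hQ h' q
  obtain ⟨s, hs⟩ := Module.projective_lifting_property g' g h'.surj
  have hs' (p : P) : g' (s p) = g p := LinearMap.congr_fun hs p
  obtain ⟨t, ht⟩ := LinearMap.exists_comp_eq_of_injective h'.inj (q := s ∘ₗ f)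
    (fun a => h'.exists_eq (by rw [LinearMap.comp_apply, hs', h.comp_apply]))
  have ht' (a : A) : f' (t a) = s (f a) := LinearMap.congr_fun ht a
  obtain ⟨k, hk⟩ := hext Q hQ (q ∘ₗ t)
  have hk' (a : A) : k (f a) = q (t a) := LinearMap.congr_fun hk a
  have hsurj : Surjective (f'.coprod s) := fun b => by
    obtain ⟨p, hp⟩ := h.surj (g' b)
    obtain ⟨a, ha⟩ := h'.exists_eq (b := b - s p) (by rw [map_sub, hs', hp, sub_self])
    exact ⟨(a, p), by simp [ha]⟩
  obtain ⟨r, hr⟩ := LinearMap.exists_comp_eq_of_surjective hsurj (q := q.coprod k) (by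
    rintro ⟨a, p⟩ hap
    rw [LinearMap.coprod_apply] at hap
    obtain ⟨x, rfl⟩ := h.exists_eq (b := p) (by
      have := congrArg g' hap
      simpa [h'.comp_apply, hs'] using this)
    rw [← ht', ← map_add] at hap
    rw [LinearMap.coprod_apply, hk', ← map_add, h'.eq_zero hap, map_zero])
  exact ⟨r, LinearMap.ext fun a => by simpa using LinearMap.congr_fun hr (a, 0)⟩

/-- The extension is made in two stages, through the preimage `H` of `A` in `Y`: from `K` to `H` the
cokernel is `A`, from `H` to `Y` it is `C`. -/
theorem ExtProjVanish.of_isSES {f : A →ₗ[R] B} {g : B →ₗ[R] C} (h : IsSES f g)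
    (hA : ExtProjVanish R A) (hC : ExtProjVanish R C) : ExtProjVanish R B := by
  intro Q K Y i p hQ h' q
  obtain ⟨H, i', j, k, h1, h2, h3⟩ := h'.exists_ker_comp h
  obtain ⟨q', hq'⟩ := hA.exists_extension h2 q
  obtain ⟨q'', hq''⟩ := hC.exists_extension h1 q'
  refine ⟨q'', ?_⟩
  rw [← h3, ← LinearMap.comp_assoc, hq'', hq']

/-- Pull the given extension back along `r`, extend the homomorphism there, and return along `y ↦
(y, i (g y))`. -/
theorem ExtProjVanish.of_retract (hB : ExtProjVanish R B) {i : A →ₗ[R] B} {r : B →ₗ[R] A}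
    (hir : r ∘ₗ i = LinearMap.id) : ExtProjVanish R A := by
  intro Q K Y f g hQ h q
  have hir' (a : A) : r (i a) = a := LinearMap.congr_fun hir a
  let W : Submodule R (Y × B) := LinearMap.eqLocus (g ∘ₗ LinearMap.fst R Y B)
    (r ∘ₗ LinearMap.snd R Y B)
  have hW : IsSES ((LinearMap.inl R Y B ∘ₗ f).codRestrict W
      (fun x => by simp [W, h.comp_apply])) (LinearMap.snd R Y B ∘ₗ W.subtype) := by
    refine isSES_mk' (fun x hx => h.eq_zero (congrArg (fun w : W => w.1.1) hx)) (fun x => rfl)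
      ?_ fun b => ?_
    · rintro ⟨⟨y, b⟩, hw : g y = r b⟩ (rfl : b = 0)
      obtain ⟨x, rfl⟩ := h.exists_eq (by simpa using hw)
      exact ⟨x, rfl⟩
    · obtain ⟨y, hy⟩ := h.surj (r b)
      exact ⟨⟨(y, b), hy⟩, rfl⟩
  obtain ⟨q', hq'⟩ := hB.exists_extension hW q
  refine ⟨q' ∘ₗ (LinearMap.id.prod (i ∘ₗ g)).codRestrict W (fun y => by simp [W, hir']), ?_⟩
  rw [← hq']
  refine LinearMap.ext fun x => congrArg q' (Subtype.ext (Prod.ext rfl ?_))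
  exact (congrArg i (h.comp_apply x)).trans (map_zero i)

theorem ExtProjVanish.of_projective [Module.Projective R C] : ExtProjVanish R C := by
  intro Q A B f g _ h q
  obtain ⟨s, hs⟩ := h.exists_section
  obtain ⟨r, hr⟩ := h.exists_retraction hs
  exact ⟨q ∘ₗ r, by rw [LinearMap.comp_assoc, hr, LinearMap.comp_id]⟩

/-- Sequences `0 ⟶ Q ⟶ B ⟶ C ⟶ 0` with `Q` projective and `Ext¹(C, Q) = 0` split. -/
theorem ExtProjVanish.exists_reverse (hC : ExtProjVanish R C) {f : Q →ₗ[R] B} {g : B →ₗ[R] C}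
    (h : IsSES f g) [Module.Projective R Q] :
    ∃ (s : C →ₗ[R] B) (r : B →ₗ[R] Q), g ∘ₗ s = LinearMap.id ∧ IsSES s r := by
  obtain ⟨r, hr⟩ := hC.exists_extension h LinearMap.id
  obtain ⟨s, hs, hsr⟩ := h.exists_reverse hr
  exact ⟨s, r, hs, hsr⟩

theorem IsGProj.extProjVanish (h : IsGProj R C) : ExtProjVanish R C := by
  obtain ⟨S, hS, hC⟩ := h
  exact (hS _ hC).1

theorem IsGProj.exists_left (h : IsGProj R C) :
    ∃ (K P : ModuleCat.{u} R) (f : K →ₗ[R] P) (g : P →ₗ[R] C),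
      Module.Projective R P ∧ IsSES f g ∧ IsGProj R K := by
  obtain ⟨S, hS, hC⟩ := h
  obtain ⟨K, P, f, g, hP, hfg, hK⟩ := (hS _ hC).2.1
  exact ⟨K, P, f, g, hP, hfg, S, hS, hK⟩

theorem IsGProj.exists_right (h : IsGProj R C) :
    ∃ (P D : ModuleCat.{u} R) (f : C →ₗ[R] P) (g : P →ₗ[R] D),
      Module.Projective R P ∧ IsSES f g ∧ IsGProj R D := by
  obtain ⟨S, hS, hC⟩ := h
  obtain ⟨K, P, f, g, hP, hfg, hK⟩ := (hS _ hC).2.2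
  exact ⟨K, P, f, g, hP, hfg, S, hS, hK⟩

theorem IsGProj.of_projective [hC : Module.Projective R C] : IsGProj R C := by
  refine ⟨fun X => Module.Projective R X, fun X hX => ⟨.of_projective, ?_, ?_⟩, hC⟩
  · exact ⟨ModuleCat.of R PUnit.{u + 1}, X, 0, (LinearEquiv.refl R X).toLinearMap, hX,
      isSES_zero_equiv _, inferInstanceAs (Module.Projective R PUnit.{u + 1})⟩
  · exact ⟨X, ModuleCat.of R PUnit.{u + 1}, (LinearEquiv.refl R X).toLinearMap, 0, hX,
      isSES_equiv_zero _, inferInstanceAs (Module.Projective R PUnit.{u + 1})⟩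

/-- The class of all such extensions is itself an `IsGProjClass`, by the two horseshoe lemmas. The
one for embeddings needs `A → P` to extend to `B`, which is Ext¹(C, P) = 0. -/
theorem IsGProj.of_isSES {f : A →ₗ[R] B} {g : B →ₗ[R] C} (h : IsSES f g)
    (hA : IsGProj R A) (hC : IsGProj R C) : IsGProj R B := by
  refine ⟨fun X => ∃ (A C : ModuleCat.{u} R) (f : A →ₗ[R] X) (g : X →ₗ[R] C),
    IsSES f g ∧ IsGProj R A ∧ IsGProj R C, ?_,
    ModuleCat.of R A, ModuleCat.of R C, f, g, h, hA, hC⟩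
  rintro X ⟨A, C, f, g, h, hA, hC⟩
  refine ⟨.of_isSES h hA.extProjVanish hC.extProjVanish, ?_, ?_⟩
  · obtain ⟨K, P, a, a', hP, ha, hK⟩ := hA.exists_left
    obtain ⟨L, Q, c, c', hQ, hc, hL⟩ := hC.exists_left
    obtain ⟨Z, b, b', i, j, hb, hij⟩ := h.exists_horseshoe_left ha hc
    exact ⟨Z, ModuleCat.of R (P × Q), b, b', inferInstanceAs (Module.Projective R (P × Q)), hb,
      K, L, i, j, hij, hK, hL⟩
  · obtain ⟨P, K, a, a', hP, ha, hK⟩ := hA.exists_right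
    obtain ⟨Q, L, c, c', hQ, hc, hL⟩ := hC.exists_right
    obtain ⟨β, hβ⟩ := hC.extProjVanish.exists_extension h a
    obtain ⟨Z, b, b', i, j, hb, hij⟩ := h.exists_horseshoe_right ha hc hβ
    exact ⟨ModuleCat.of R (P × Q), Z, b, b', inferInstanceAs (Module.Projective R (P × Q)), hb,
      K, L, i, j, hij, hK, hL⟩

theorem IsGProj.of_equiv (e : A ≃ₗ[R] B) (hA : IsGProj R A) : IsGProj R B :=
  .of_isSES (isSES_equiv_zero e) hA (.of_projective (C := PUnit.{u + 1}))

theorem IsGProj.of_subsingleton [Subsingleton A] : IsGProj R A := .of_projective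

/-- A syzygy of a Gorenstein projective module is the first syzygy in its resolution up to
projective summands. -/
theorem IsGProj.exists_stable_syzygy {f : A →ₗ[R] P} {g : P →ₗ[R] D} (h : IsSES f g)
    [Module.Projective R P] (hD : IsGProj R D) :
    ∃ (X Q : ModuleCat.{u} R) (i : A →ₗ[R] X) (j : X →ₗ[R] Q), IsGProj R X ∧
      Module.Projective R Q ∧ IsSES i j := by
  obtain ⟨K, Q, a, b, hQ, hab, hK⟩ := hD.exists_left
  obtain ⟨X, i, j, i', j', h1, h2⟩ := h.exists_pullback hab
  exact ⟨X, Q, i, j, .of_isSES h2 hK .of_projective, hQ, h1⟩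

/-- Adjoin these syzygies to the class. The step to the right is the given sequence; Ext¹ vanishing
and the step to the left come from `A` being a direct summand, with projective complement, of a
Gorenstein projective `X`. -/
theorem IsGProj.of_isSES_projective {f : A →ₗ[R] P} {g : P →ₗ[R] D} (h : IsSES f g)
    [hP : Module.Projective R P] (hD : IsGProj R D) : IsGProj R A := by
  refine ⟨fun A => IsGProj R A ∨ ∃ (P D : ModuleCat.{u} R) (f : A →ₗ[R] P) (g : P →ₗ[R] D),
    Module.Projective R P ∧ IsSES f g ∧ IsGProj R D, ?_,
    .inr ⟨ModuleCat.of R P, ModuleCat.of R D, f, g, hP, h, hD⟩⟩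
  rintro A (hA | ⟨P, D, f, g, hP, h, hD⟩)
  · obtain ⟨K, P, a, a', hP, ha, hK⟩ := hA.exists_left
    obtain ⟨Q, L, c, c', hQ, hc, hL⟩ := hA.exists_right
    exact ⟨hA.extProjVanish, ⟨K, P, a, a', hP, ha, .inl hK⟩, ⟨Q, L, c, c', hQ, hc, .inl hL⟩⟩
  obtain ⟨X, Q, i, j, hX, hQ, hij⟩ := IsGProj.exists_stable_syzygy h hD
  obtain ⟨s, hs⟩ := hij.exists_section
  obtain ⟨r, hr⟩ := hij.exists_retraction hs
  obtain ⟨t, _, htr⟩ := hij.exists_reverse hr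
  obtain ⟨L, PX, a, a', hPX, ha, hL⟩ := hX.exists_left
  -- The kernel of `PX → X → A` is an extension of the complement `Q` by `L`, hence Gorenstein
  -- projective.
  obtain ⟨H, b, c, d, hb, hcd, -⟩ := ha.exists_ker_comp htr
  exact ⟨hX.extProjVanish.of_retract hr,
    ⟨H, PX, b, _, hPX, hb, .inl (.of_isSES hcd hL .of_projective)⟩,
    ⟨P, D, f, g, hP, h, .inl hD⟩⟩

/-- The kernel of an epimorphism of Gorenstein projective modules is Gorenstein projective. -/
theorem IsGProj.of_ker {f : A →ₗ[R] B} {g : B →ₗ[R] C} (h : IsSES f g)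
    (hB : IsGProj R B) (hC : IsGProj R C) : IsGProj R A := by
  obtain ⟨P, D, a, b, hP, hab, hD⟩ := hB.exists_right
  -- `P / A` is an extension of `D` by `C`, so `A` is a syzygy of a Gorenstein projective.
  obtain ⟨N, p, i, j, hp, hij⟩ := h.exists_coker_comp hab
  exact .of_isSES_projective hp (.of_isSES hij hC hD)

theorem IsGProj.projective_of_hasSyzygy {f : A →ₗ[R] P} {g : P →ₗ[R] C} (h : IsSES f g)
    [Module.Projective R P] [Module.Projective R A] (hC : IsGProj R C) :
    Module.Projective R C := by
  obtain ⟨s, r, hs, -⟩ := hC.extProjVanish.exists_reverse h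
  exact Module.Projective.of_split s g hs

end GorensteinProjective

/-! ### Comparison with the definition by complete resolutions -/

section TotalComplex

theorem exists_int_sequence {α : Type*} {r : α → α → Prop} (hr : ∀ x, ∃ y, r x y)
    (hl : ∀ x, ∃ y, r y x) (a : α) :
    ∃ F : ℤ → α, F (0 + 1) = a ∧ ∀ i, r (F i) (F (i + 1)) := by
  choose nx hnx using hr
  choose pv hpv using hl
  let G : ℤ → α := fun i => match i with
    | .ofNat n => nx^[n] a
    | .negSucc n => pv^[n + 1] a
  have hG (i : ℤ) : r (G i) (G (i + 1)) := by
    match i with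
    | .ofNat n =>
      change r (nx^[n] a) (nx^[n + 1] a)
      rw [iterate_succ_apply']
      exact hnx _
    | .negSucc 0 => exact hpv a
    | .negSucc (n + 1) =>
      change r (pv^[n + 1 + 1] a) (pv^[n + 1] a)
      rw [iterate_succ_apply']
      exact hpv _
  -- The shift puts `a` at index 1, since the module is the image of `P 0 → P 1`.
  refine ⟨fun i => G (i - 1), rfl, fun i => ?_⟩
  have := hG (i - 1)
  rwa [show i - 1 + 1 = i + 1 - 1 by ring] at this

variable {R : Type u} [CommRing R]

theorem Function.Exact.isSES_range {A B C : Type u} [AddCommGroup A] [Module R A]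
    [AddCommGroup B] [Module R B] [AddCommGroup C] [Module R C] {f : A →ₗ[R] B} {g : B →ₗ[R] C}
    (h : Exact f g) : IsSES (LinearMap.range f).subtype g.rangeRestrict :=
  isSES_mk' (fun a ha => by simpa using ha)
    (fun ⟨_, a, ha⟩ => Subtype.ext (by subst ha; exact (h _).2 ⟨a, rfl⟩))
    (fun b hb => ⟨⟨b, (h b).1 (congrArg Subtype.val hb)⟩, rfl⟩) g.surjective_rangeRestrict

theorem IsSES.congr_right {A B C D : Type u} [AddCommGroup A] [Module R A]
    [AddCommGroup B] [Module R B] [AddCommGroup C] [Module R C] [AddCommGroup D] [Module R D]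
    {f : A →ₗ[R] B} {g : B →ₗ[R] C} (h : IsSES f g) (e : D ≃ₗ[R] C) :
    IsSES f (e.symm.toLinearMap ∘ₗ g) :=
  isSES_mk' (fun _ => h.eq_zero) (fun a => by simp [h.comp_apply])
    (fun b hb => h.exists_eq (by simpa using hb)) (e.symm.surjective.comp h.surj)

theorem IsSES.congr_left {A B C D : Type u} [AddCommGroup A] [Module R A]
    [AddCommGroup B] [Module R B] [AddCommGroup C] [Module R C] [AddCommGroup D] [Module R D]
    {f : A →ₗ[R] B} {g : B →ₗ[R] C} (h : IsSES f g) (e : D ≃ₗ[R] A) :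
    IsSES (f ∘ₗ e.toLinearMap) g :=
  isSES_mk' (fun d hd => by simpa using h.eq_zero hd) (fun a => h.comp_apply _)
    (fun b hb => by
      obtain ⟨a, rfl⟩ := h.exists_eq hb
      exact ⟨e.symm a, by simp⟩) h.surj

theorem IsGorensteinProjective.isGProj {M : ModuleCat.{u} R} (h : IsGorensteinProjective M) :
    IsGProj R M := by
  obtain ⟨P, d, hP, hd, hQ, ⟨e⟩⟩ := h
  refine ⟨fun X => ∃ i, Nonempty (X ≃ₗ[R] LinearMap.range (d i)), ?_, 0, ⟨e⟩⟩
  rintro X ⟨i, ⟨e⟩⟩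
  -- Written this way, the two preceding differentials have matching types without casts.
  obtain ⟨k, rfl⟩ : ∃ k, i = k + 1 + 1 := ⟨i - 2, by ring⟩
  have h1 := (hd (k + 1)).isSES_range.congr_right e
  have h2 := (hd (k + 1 + 1)).isSES_range.congr_left e
  refine ⟨?_, ⟨ModuleCat.of R (LinearMap.range (d (k + 1))), P (k + 1 + 1), _, _, hP _, h1,
    k + 1, ⟨LinearEquiv.refl R _⟩⟩, ⟨P (k + 1 + 1 + 1),
    ModuleCat.of R (LinearMap.range (d (k + 1 + 1 + 1))), _, _, hP _, h2,
    k + 1 + 1 + 1, ⟨LinearEquiv.refl R _⟩⟩⟩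
  have := hP (k + 1 + 1)
  refine .of_projective_middle h1 fun Q hQp q => ?_
  have hq : (q ∘ₗ (d (k + 1)).rangeRestrict) ∘ₗ d k = 0 := LinearMap.ext fun x =>
    (congrArg q (Subtype.ext ((hd k _).2 ⟨x, rfl⟩))).trans (map_zero q)
  obtain ⟨q', hq'⟩ := (hQ Q hQp k _).1 hq
  refine ⟨q', LinearMap.ext ?_⟩
  rintro ⟨_, x, rfl⟩
  exact LinearMap.congr_fun hq' x

/-- Choose sequences `F i → P i → F (i + 1)` in both directions and splice them; Ext¹ vanishing of
the modules `F i` makes Hom into projectives exact. -/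
theorem IsGProj.isGorensteinProjective {M : ModuleCat.{u} R} (h : IsGProj R M) :
    IsGorensteinProjective M := by
  let α := {X : ModuleCat.{u} R // IsGProj R X}
  obtain ⟨F, hF0, hF⟩ := exists_int_sequence (α := α)
    (r := fun X Y => ∃ (P : ModuleCat.{u} R) (f : X.1 →ₗ[R] P) (g : P →ₗ[R] Y.1),
      Module.Projective R P ∧ IsSES f g)
    (fun X => by
      obtain ⟨P, D, f, g, hP, hfg, hD⟩ := X.2.exists_right
      exact ⟨⟨D, hD⟩, P, f, g, hP, hfg⟩)
    (fun X => by
      obtain ⟨K, P, f, g, hP, hfg, hK⟩ := X.2.exists_left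
      exact ⟨⟨K, hK⟩, P, f, g, hP, hfg⟩) ⟨M, h⟩
  have e : Nonempty (M ≃ₗ[R] (F (0 + 1)).1) := by rw [hF0]; exact ⟨LinearEquiv.refl R M⟩
  choose P f g hP hfg using hF
  refine ⟨P, fun i => f (i + 1) ∘ₗ g i, hP, fun i x => ?_, fun Q hQ i q => ?_, ?_⟩
  · constructor
    · intro hx
      obtain ⟨y, rfl⟩ := (hfg (i + 1)).exists_eq ((hfg (i + 1 + 1)).eq_zero hx)
      obtain ⟨z, rfl⟩ := (hfg i).surj y
      exact ⟨z, rfl⟩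
    · rintro ⟨z, rfl⟩
      simp [(hfg (i + 1)).comp_apply]
  · constructor
    · intro hq
      obtain ⟨v, hv⟩ := LinearMap.exists_comp_eq_of_surjective (hfg (i + 1)).surj (q := q)
        (fun x hx => by
          obtain ⟨y, rfl⟩ := (hfg (i + 1)).exists_eq hx
          obtain ⟨z, rfl⟩ := (hfg i).surj y
          exact LinearMap.congr_fun hq z)
      obtain ⟨w, hw⟩ := (F (i + 1 + 1 + 1)).2.extProjVanish.exists_extension
        (hfg (i + 1 + 1)) v
      refine ⟨w, ?_⟩
      change w ∘ₗ (f (i + 1 + 1) ∘ₗ g (i + 1)) = q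
      rw [← LinearMap.comp_assoc, hw, hv]
    · rintro ⟨w, rfl⟩
      refine LinearMap.ext fun z => ?_
      simp [(hfg (i + 1)).comp_apply]
  · obtain ⟨e⟩ := e
    have hr : LinearMap.range (f (0 + 1) ∘ₗ g 0) = LinearMap.range (f (0 + 1)) :=
      LinearMap.range_comp_of_range_eq_top _ (LinearMap.range_eq_top.2 (hfg 0).surj)
    exact ⟨e.trans ((LinearEquiv.ofInjective _ (hfg (0 + 1)).inj).trans
      (LinearEquiv.ofEq _ _ hr.symm))⟩

end TotalComplex

/-! ### Resolutions by finitely generated projectives -/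

section Resolutions

variable {R : Type u} [CommRing R]

/-- Adding one term to a left resolution. -/
theorem IsLeftResolution.exists_cons {K G M : ModuleCat.{u} R} {f : K →ₗ[R] G} {g : G →ₗ[R] M}
    (h : IsSES f g) {X : ℕ → ModuleCat.{u} R} {d : ∀ i, X (i + 1) →ₗ[R] X i} {ε : X 0 →ₗ[R] K}
    (hX : IsLeftResolution d ε) :
    ∃ (Y : ℕ → ModuleCat.{u} R) (d' : ∀ i, Y (i + 1) →ₗ[R] Y i) (ε' : Y 0 →ₗ[R] M),
      IsLeftResolution d' ε' ∧ Y 0 = G ∧ ∀ i, Y (i + 1) = X i := by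
  let Y : ℕ → ModuleCat.{u} R := fun i => match i with
    | 0 => G
    | i + 1 => X i
  let d' : ∀ i, Y (i + 1) →ₗ[R] Y i := fun i => match i with
    | 0 => f ∘ₗ ε
    | i + 1 => d i
  refine ⟨Y, d', g, ⟨h.surj, fun x => ⟨fun hx => ?_, ?_⟩, fun i => ?_⟩, rfl, fun _ => rfl⟩
  · obtain ⟨k, rfl⟩ := h.exists_eq hx
    obtain ⟨x, rfl⟩ := hX.surjective k
    exact ⟨x, rfl⟩
  · rintro ⟨x, rfl⟩
    exact h.comp_apply (ε x)
  · match i with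
    | 0 =>
      intro x
      refine ⟨fun hx => (hX.exact_zero x).1 (h.eq_zero hx), fun hx => ?_⟩
      exact (congrArg f ((hX.exact_zero x).2 hx)).trans (map_zero f)
    | i + 1 => exact hX.exact_succ i

/-- Splitting off the first term of a left resolution. -/
theorem IsLeftResolution.exists_tail {M : ModuleCat.{u} R} {X : ℕ → ModuleCat.{u} R}
    {d : ∀ i, X (i + 1) →ₗ[R] X i} {ε : X 0 →ₗ[R] M} (hX : IsLeftResolution d ε) :
    ∃ (K : ModuleCat.{u} R) (f : K →ₗ[R] X 0) (ε' : X (0 + 1) →ₗ[R] K),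
      IsSES f ε ∧ IsLeftResolution (X := fun i => X (i + 1)) (fun i => d (i + 1)) ε' := by
  refine ⟨ModuleCat.of R (LinearMap.ker ε), (LinearMap.ker ε).subtype,
    (d 0).codRestrict (LinearMap.ker ε) (fun x => (hX.exact_zero _).2 ⟨x, rfl⟩),
    isSES_ker hX.surjective, ⟨?_, fun x => ?_, fun i => hX.exact_succ (i + 1)⟩⟩
  · rintro ⟨x, hx⟩
    obtain ⟨y, rfl⟩ := (hX.exact_zero x).1 hx
    exact ⟨y, rfl⟩
  · rw [← hX.exact_succ 0 x]
    exact ⟨fun h => congrArg Subtype.val h, fun h => Subtype.ext h⟩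

theorem HasFGProjectiveResolution.exists_isSES {M : ModuleCat.{u} R}
    (h : HasFGProjectiveResolution M) :
    ∃ (K P : ModuleCat.{u} R) (f : K →ₗ[R] P) (g : P →ₗ[R] M), IsSES f g ∧
      Module.Projective R P ∧ Module.Finite R P ∧ HasFGProjectiveResolution K := by
  obtain ⟨P, d, ε, hε, hP⟩ := h
  obtain ⟨K, f, ε', hf, hK⟩ := hε.exists_tail
  exact ⟨K, P 0, f, ε, hf, (hP 0).1, (hP 0).2, _, _, ε', hK, fun i => hP (i + 1)⟩

theorem HasFGProjectiveResolution.of_isSES {K P M : ModuleCat.{u} R} {f : K →ₗ[R] P}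
    {g : P →ₗ[R] M} (h : IsSES f g) (hP : Module.Projective R P) (hP' : Module.Finite R P)
    (hK : HasFGProjectiveResolution K) : HasFGProjectiveResolution M := by
  obtain ⟨X, d, ε, hε, hX⟩ := hK
  obtain ⟨Y, d', ε', hε', hY0, hY⟩ := IsLeftResolution.exists_cons h hε
  refine ⟨Y, d', ε', hε', fun i => ?_⟩
  cases i with
  | zero => rw [hY0]; exact ⟨hP, hP'⟩
  | succ i => rw [hY i]; exact hX i

theorem HasFGProjectiveResolution.of_equiv {M N : ModuleCat.{u} R}
    (h : HasFGProjectiveResolution M) (e : N ≃ₗ[R] M) : HasFGProjectiveResolution N := by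
  obtain ⟨K, P, f, g, hfg, hP, hP', hK⟩ := h.exists_isSES
  exact .of_isSES (hfg.congr_right e) hP hP' hK

theorem HasFGProjectiveResolution.of_subsingleton {M : ModuleCat.{u} R} [Subsingleton M] :
    HasFGProjectiveResolution M :=
  ⟨fun _ => M, fun _ => 0, 0,
    ⟨fun _ => ⟨0, Subsingleton.elim _ _⟩,
      fun _ => ⟨fun _ => ⟨0, Subsingleton.elim _ _⟩, fun _ => rfl⟩,
      fun _ _ => ⟨fun _ => ⟨0, Subsingleton.elim _ _⟩, fun _ => rfl⟩⟩,
    fun _ => ⟨inferInstance, inferInstance⟩⟩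

theorem HasFGProjectiveResolution.of_projective {M : ModuleCat.{u} R}
    (hM : Module.Projective R M) (hM' : Module.Finite R M) : HasFGProjectiveResolution M :=
  have : Subsingleton (ModuleCat.of R PUnit.{u + 1}) := inferInstanceAs (Subsingleton PUnit)
  .of_isSES (K := ModuleCat.of R PUnit.{u + 1}) (isSES_zero_equiv (LinearEquiv.refl R M)) hM hM'
    .of_subsingleton

theorem HasFGProjectiveResolution.finitePresentation {M : ModuleCat.{u} R}
    (h : HasFGProjectiveResolution M) : Module.FinitePresentation R M := by
  obtain ⟨K, P, f, g, hfg, hP, hP', hK⟩ := h.exists_isSES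
  obtain ⟨_, Q, _, g', hg', _, hQ', _⟩ := hK.exists_isSES
  have := Module.finitePresentation_of_projective R P
  refine Module.finitePresentation_of_surjective g hfg.surj ?_
  rw [LinearMap.exact_iff.1 hfg.exact, ← LinearMap.range_comp_of_range_eq_top (f := g') f
    (LinearMap.range_eq_top.2 hg'.surj)]
  exact Module.Finite.iff_fg.1 inferInstance

/-- A split extension of a module with a resolution by finitely generated projectives by a
finitely generated projective module again has such a resolution. -/
theorem HasFGProjectiveResolution.of_isSES_projective_left {P Y C : ModuleCat.{u} R}
    {f : P →ₗ[R] Y} {g : Y →ₗ[R] C} (h : IsSES f g) (hP : Module.Projective R P)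
    (hP' : Module.Finite R P) (hC : HasFGProjectiveResolution C) :
    HasFGProjectiveResolution Y := by
  obtain ⟨K, Q, a, b, hab, hQ, hQ', hK⟩ := hC.exists_isSES
  obtain ⟨Z, c, d, i, j, hcd, hij⟩ := h.exists_horseshoe_left
    (isSES_zero_equiv (LinearEquiv.refl R P)) hab
  have hj : Injective j := (injective_iff_map_eq_zero j).2 fun z hz => by
    obtain ⟨x, rfl⟩ := hij.exists_eq hz
    rw [Subsingleton.elim x 0, map_zero]
  have := hP
  exact .of_isSES (P := ModuleCat.of R (P × Q)) hcd
    (inferInstanceAs (Module.Projective R (P × Q))) (inferInstanceAs (Module.Finite R (P × Q)))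
    (hK.of_equiv (LinearEquiv.ofBijective j ⟨hj, hij.surj⟩))

end Resolutions

open CategoryTheory

/-! ### Gorenstein projective versus projective dimension -/

section Dimension

variable {R : Type u} [CommRing R]

/-- `GProjDimLT n M` is the inductive form of `HasGorensteinProjectiveDimensionLT M n`. -/
def GProjDimLT : ℕ → ModuleCat.{u} R → Prop
  | 0, M => Subsingleton M
  | n + 1, M => ∃ (K G : ModuleCat.{u} R) (f : K →ₗ[R] G) (g : G →ₗ[R] M),
      IsSES f g ∧ IsGProj R G ∧ GProjDimLT n K

theorem GProjDimLT.hasGorensteinProjectiveDimensionLT {n : ℕ} {M : ModuleCat.{u} R}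
    (h : GProjDimLT n M) : HasGorensteinProjectiveDimensionLT M n := by
  induction n generalizing M with
  | zero =>
    have : Subsingleton M := h
    exact ⟨fun _ => M, fun _ => 0, 0, ⟨fun _ => ⟨0, Subsingleton.elim _ _⟩,
      fun _ => ⟨fun _ => ⟨0, Subsingleton.elim _ _⟩, fun _ => rfl⟩,
      fun _ _ => ⟨fun _ => ⟨0, Subsingleton.elim _ _⟩, fun _ => rfl⟩⟩,
      fun _ => IsGProj.of_subsingleton.isGorensteinProjective, fun _ _ => this⟩
  | succ n ih =>
    obtain ⟨K, G, f, g, hfg, hG, hK⟩ := h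
    obtain ⟨X, d, ε, hε, hX, hn⟩ := ih hK
    obtain ⟨Y, d', ε', hε', hY0, hY⟩ := IsLeftResolution.exists_cons hfg hε
    refine ⟨Y, d', ε', hε', fun i => ?_, fun i hi => ?_⟩
    · cases i with
      | zero => rw [hY0]; exact hG.isGorensteinProjective
      | succ i => rw [hY i]; exact hX i
    · obtain ⟨i, rfl⟩ := Nat.exists_eq_add_of_le' (Nat.one_le_of_lt hi)
      rw [hY i]
      exact hn i (Nat.le_of_succ_le_succ hi)

theorem gProjDimLT_of_hasGorensteinProjectiveDimensionLT {n : ℕ} {M : ModuleCat.{u} R}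
    (h : HasGorensteinProjectiveDimensionLT M n) : GProjDimLT n M := by
  induction n generalizing M with
  | zero =>
    obtain ⟨G, d, ε, hε, -, hn⟩ := h
    have := hn 0 le_rfl
    exact hε.surjective.subsingleton
  | succ n ih =>
    obtain ⟨G, d, ε, hε, hG, hn⟩ := h
    obtain ⟨K, f, ε', hf, hK⟩ := hε.exists_tail
    exact ⟨K, G 0, f, ε, hf, (hG 0).isGProj, ih ⟨_, _, ε', hK, fun i => hG (i + 1),
      fun i hi => hn (i + 1) (Nat.succ_le_succ hi)⟩⟩

theorem hasGorensteinProjectiveDimensionLT_iff_gProjDimLT {n : ℕ} {M : ModuleCat.{u} R} :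
    HasGorensteinProjectiveDimensionLT M n ↔ GProjDimLT n M :=
  ⟨gProjDimLT_of_hasGorensteinProjectiveDimensionLT,
    fun h => h.hasGorensteinProjectiveDimensionLT⟩

theorem GProjDimLT.succ {n : ℕ} {M : ModuleCat.{u} R} (h : GProjDimLT n M) :
    GProjDimLT (n + 1) M := by
  induction n generalizing M with
  | zero =>
    have : Subsingleton M := h
    exact ⟨ModuleCat.of R PUnit.{u + 1}, M, 0, _, isSES_zero_equiv (LinearEquiv.refl R M),
      .of_subsingleton, inferInstanceAs (Subsingleton PUnit)⟩
  | succ n ih =>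
    obtain ⟨K, G, f, g, hfg, hG, hK⟩ := h
    exact ⟨K, G, f, g, hfg, hG, ih hK⟩

/-- The kernel of an epimorphism onto a Gorenstein projective module. -/
theorem GProjDimLT.of_ker {n : ℕ} {A B C : ModuleCat.{u} R} {f : A →ₗ[R] B} {g : B →ₗ[R] C}
    (h : IsSES f g) (hB : GProjDimLT n B) (hC : IsGProj R C) : GProjDimLT n A := by
  cases n with
  | zero =>
    have : Subsingleton B := hB
    exact h.inj.subsingleton
  | succ n =>
    obtain ⟨K, G, a, b, hab, hG, hK⟩ := hB
    -- The kernel `H` of `G → B → C` is Gorenstein projective and maps onto `A` with the same kernel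
    -- `K`.
    obtain ⟨H, i, j, k, hi, hjk, -⟩ := hab.exists_ker_comp h
    exact ⟨K, H, j, k, hjk, .of_ker hi hG hC, hK⟩

theorem GProjDimLT.of_isSES_projective_right {n : ℕ} {A B P : ModuleCat.{u} R} {f : A →ₗ[R] B}
    {g : B →ₗ[R] P} (h : IsSES f g) (hP : Module.Projective R P) (hA : GProjDimLT (n + 1) A) :
    GProjDimLT (n + 1) B := by
  obtain ⟨K, G, a, b, hab, hG, hK⟩ := hA
  obtain ⟨Z, c, d, i, j, hcd, hij⟩ := h.exists_horseshoe_left hab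
    (isSES_zero_equiv (LinearEquiv.refl R P))
  have e : Nonempty (K ≃ₗ[R] Z) :=
    ⟨LinearEquiv.ofBijective i ⟨hij.inj, fun z => hij.exists_eq (Subsingleton.elim _ _)⟩⟩
  obtain ⟨e⟩ := e
  exact ⟨K, ModuleCat.of R (G × P), _, d, hcd.congr_left e,
    .of_isSES isSES_inl_snd hG .of_projective, hK⟩

/-- The pullback of `G → M` and `P → M` is an extension of `P` by `L`, and `K` is the kernel of its
projection onto `G`. The bound starts at `n + 2` because a syzygy of a Gorenstein projective need
not vanish. -/
theorem GProjDimLT.syzygy {n : ℕ} {K P M : ModuleCat.{u} R} {f : K →ₗ[R] P} {g : P →ₗ[R] M}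
    (h : IsSES f g) (hP : Module.Projective R P) (hM : GProjDimLT (n + 2) M) :
    GProjDimLT (n + 1) K := by
  obtain ⟨L, G, a, b, hab, hG, hL⟩ := hM
  obtain ⟨X, i, j, i', j', h1, h2⟩ := hab.exists_pullback h
  exact .of_ker h2 (.of_isSES_projective_right h1 hP hL) hG

theorem IsSES.shortExact {A B C : ModuleCat.{u} R} {f : A →ₗ[R] B} {g : B →ₗ[R] C}
    (h : IsSES f g) :
    (ModuleCat.shortComplexOfCompEqZero f g h.exact.linearMap_comp_eq_zero).ShortExact :=
  ModuleCat.shortComplex_shortExact _ h.exact h.inj h.surj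

theorem hasProjectiveDimensionLT_one_iff {M : ModuleCat.{u} R} :
    HasProjectiveDimensionLT M 1 ↔ Module.Projective R M :=
  projective_iff_hasProjectiveDimensionLT_one.symm.trans
    (IsProjective.iff_projective (R := R) M).symm

theorem IsSES.hasProjectiveDimensionLT_iff {n : ℕ} {K P M : ModuleCat.{u} R} {f : K →ₗ[R] P}
    {g : P →ₗ[R] M} (h : IsSES f g) (hP : Module.Projective R P) :
    HasProjectiveDimensionLT M (n + 2) ↔ HasProjectiveDimensionLT K (n + 1) :=
  h.shortExact.hasProjectiveDimensionLT_X₃_iff n ((IsProjective.iff_projective (R := R) P).1 hP)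

theorem GProjDimLT.of_hasProjectiveDimensionLT {n : ℕ} {M : ModuleCat.{u} R}
    (h : HasProjectiveDimensionLT M n) : GProjDimLT n M := by
  induction n generalizing M with
  | zero =>
    exact ModuleCat.isZero_iff_subsingleton.1 (isZero_of_hasProjectiveDimensionLT_zero M)
  | succ n ih =>
    obtain _ | n := n
    · have := hasProjectiveDimensionLT_one_iff.1 h
      exact ⟨ModuleCat.of R PUnit.{u + 1}, M, 0, _, isSES_zero_equiv (LinearEquiv.refl R M),
        .of_projective, inferInstanceAs (Subsingleton PUnit)⟩
    · obtain ⟨K, P, f, g, hP, hfg⟩ := exists_projective_presentation R M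
      exact ⟨K, P, f, g, hfg, .of_projective, ih ((hfg.hasProjectiveDimensionLT_iff hP).1 h)⟩

/-- Gorenstein projective modules of finite projective dimension are projective. -/
theorem IsGProj.projective_of_hasProjectiveDimensionLT {n : ℕ} {M : ModuleCat.{u} R}
    (hM : IsGProj R M) (h : HasProjectiveDimensionLT M (n + 1)) : Module.Projective R M := by
  induction n generalizing M with
  | zero => exact hasProjectiveDimensionLT_one_iff.1 h
  | succ n ih =>
    obtain ⟨K, P, f, g, hP, hfg, hK⟩ := hM.exists_left
    have := ih hK ((hfg.hasProjectiveDimensionLT_iff hP).1 h)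
    exact hM.projective_of_hasSyzygy hfg

/-- Projective syzygies lower both dimensions together until a Gorenstein projective of finite
projective dimension remains. The value of `k` is immaterial; it only records finiteness. -/
theorem GProjDimLT.hasProjectiveDimensionLT {n k : ℕ} {M : ModuleCat.{u} R}
    (hM : GProjDimLT n M) (h : HasProjectiveDimensionLT M (k + 1)) :
    HasProjectiveDimensionLT M n := by
  induction n generalizing k M with
  | zero => exact (ModuleCat.isZero_iff_subsingleton.2 hM).hasProjectiveDimensionLT_zero
  | succ n ih =>
    obtain _ | n := n
    · obtain ⟨K, G, f, g, hfg, hG, hK⟩ := hM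
      have : Subsingleton K := hK
      have hg : Injective g := (injective_iff_map_eq_zero g).2 fun x hx => by
        obtain ⟨y, rfl⟩ := hfg.exists_eq hx
        rw [Subsingleton.elim y 0, map_zero]
      exact hasProjectiveDimensionLT_one_iff.2
        ((hG.of_equiv (LinearEquiv.ofBijective g
          ⟨hg, hfg.surj⟩)).projective_of_hasProjectiveDimensionLT h)
    · obtain ⟨K, P, f, g, hP, hfg⟩ := exists_projective_presentation R M
      -- Weakening the bound by one keeps the bound for the syzygy of the form `k + 1`, even when `k
      -- = 0`.
      have : HasProjectiveDimensionLT M (k + 2) :=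
        hasProjectiveDimensionLT_of_ge M (k + 1) (k + 2) (Nat.le_succ _)
      exact (hfg.hasProjectiveDimensionLT_iff hP).2
        (ih (hM.syzygy hfg hP) ((hfg.hasProjectiveDimensionLT_iff hP).1 this))

theorem exists_gProjDimLT_of_ne_top {M : ModuleCat.{u} R}
    (h : gorensteinProjectiveDimension M ≠ ⊤) : ∃ n, GProjDimLT n M := by
  by_contra! hM
  refine h (sInf_eq_top.2 fun a ha => ?_)
  by_contra hne
  obtain ⟨i, hi⟩ : ∃ i : ℕ, a < i := by
    induction a with
    | bot => exact ⟨0, WithBot.bot_lt_coe _⟩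
    | coe a =>
      induction a with
      | top => exact absurd rfl hne
      | coe a => exact ⟨a + 1, by exact_mod_cast Nat.lt_succ_self a⟩
  exact hM i (gProjDimLT_of_hasGorensteinProjectiveDimensionLT (ha i hi))

/-- The Gorenstein projective dimension is the projective dimension if the latter is finite. -/
theorem gorensteinProjectiveDimension_eq {M : ModuleCat.{u} R}
    (h : projectiveDimension M ≠ ⊤) :
    gorensteinProjectiveDimension M = projectiveDimension M := by
  obtain ⟨k, hk⟩ := (projectiveDimension_ne_top_iff M).1 h
  have (i : ℕ) : HasGorensteinProjectiveDimensionLT M i ↔ HasProjectiveDimensionLT M i :=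
    hasGorensteinProjectiveDimensionLT_iff_gProjDimLT.trans
      ⟨fun hi => hi.hasProjectiveDimensionLT hk, .of_hasProjectiveDimensionLT⟩
  simp only [gorensteinProjectiveDimension, projectiveDimension, this]

theorem gorensteinProjectiveDimension_le_of_ker {M N C : ModuleCat.{u} R} {f : M →ₗ[R] N}
    {g : N →ₗ[R] C} (h : IsSES f g) (hC : IsGProj R C) :
    gorensteinProjectiveDimension M ≤ gorensteinProjectiveDimension N :=
  sInf_le_sInf fun _ ha i hi => hasGorensteinProjectiveDimensionLT_iff_gProjDimLT.2
    (.of_ker h (gProjDimLT_of_hasGorensteinProjectiveDimensionLT (ha i hi)) hC)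

end Dimension

/-! ### Coherence: finite coresolutions and the embedding -/

section Coherent

variable {R : Type u} [CommRing R]

/-- Finitely generated submodules of finite free modules over a coherent ring are finitely
presented. -/
theorem IsCoherentRing.finitePresentation_of_injective (hR : IsCoherentRing R) {n : ℕ}
    {N : Type u} [AddCommGroup N] [Module R N] [Module.Finite R N] {φ : N →ₗ[R] (Fin n → R)}
    (hφ : Injective φ) : Module.FinitePresentation R N := by
  induction n generalizing N with
  | zero =>
    have := hφ.subsingleton
    infer_instance
  | succ n ih =>
    -- The image of the first coordinate is a finitely generated ideal, and its kernel embeds in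
    -- `Fin n → R`.
    let g : N →ₗ[R] R := LinearMap.proj 0 ∘ₗ φ
    have hfp : Module.FinitePresentation R (LinearMap.range g) :=
      hR (LinearMap.range g) (Module.Finite.iff_fg.1 inferInstance)
    have hker : (LinearMap.ker g.rangeRestrict).FG :=
      Module.FinitePresentation.fg_ker g.rangeRestrict g.surjective_rangeRestrict
    have : Module.Finite R (LinearMap.ker g.rangeRestrict) := Module.Finite.iff_fg.2 hker
    let ψ : LinearMap.ker g.rangeRestrict →ₗ[R] (Fin n → R) :=
      LinearMap.funLeft R R Fin.succ ∘ₗ φ ∘ₗ (LinearMap.ker g.rangeRestrict).subtype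
    have hψ : Injective ψ := (injective_iff_map_eq_zero ψ).2 fun x hx => by
      refine Subtype.ext ((injective_iff_map_eq_zero φ).1 hφ _ (funext fun i => ?_))
      refine Fin.cases ?_ (fun i => congrFun hx i) i
      exact congrArg Subtype.val x.2
    have := ih hψ
    exact Module.finitePresentation_of_ker g.rangeRestrict g.surjective_rangeRestrict

theorem IsCoherentRing.fg_ker (hR : IsCoherentRing R) {n : ℕ} {F : Type u} [AddCommGroup F]
    [Module R F] [Module.Finite R F] (T : F →ₗ[R] (Fin n → R)) : (LinearMap.ker T).FG := by
  have : Module.FinitePresentation R (LinearMap.range T) :=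
    hR.finitePresentation_of_injective (φ := (LinearMap.range T).subtype) Subtype.val_injective
  rw [← LinearMap.ker_rangeRestrict]
  exact Module.FinitePresentation.fg_ker T.rangeRestrict T.surjective_rangeRestrict

/-- Over a coherent ring, the dual of a finitely presented module is finitely generated. -/
theorem IsCoherentRing.finite_dual (hR : IsCoherentRing R) (G : Type u) [AddCommGroup G]
    [Module R G] [Module.FinitePresentation R G] : Module.Finite R (Module.Dual R G) := by
  obtain ⟨n, f, hf⟩ := Module.Finite.exists_fin' R G
  have hker := Module.FinitePresentation.fg_ker f hf
  have : Module.Finite R (LinearMap.ker f) := Module.Finite.iff_fg.2 hker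
  obtain ⟨m, t, ht⟩ := Module.Finite.exists_fin' R (LinearMap.ker f)
  -- `T` evaluates a functional at generators of `ker f`, so its kernel consists of the functionals
  -- that descend to `G`.
  let T : Module.Dual R (Fin n → R) →ₗ[R] (Fin m → R) :=
    LinearMap.pi fun j => LinearMap.applyₗ (t (Pi.single j 1)).1
  let L : Module.Dual R G →ₗ[R] Module.Dual R (Fin n → R) := LinearMap.lcomp R R f
  have hL : Injective L := fun a b hab => LinearMap.ext fun x => by
    obtain ⟨y, rfl⟩ := hf x
    exact LinearMap.congr_fun hab y
  have hLT : LinearMap.range L = LinearMap.ker T := by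
    ext φ
    constructor
    · rintro ⟨a, rfl⟩
      refine funext fun j => ?_
      exact (congrArg a (t (Pi.single j 1)).2).trans (map_zero a)
    · intro hφ
      have h0 : (φ ∘ₗ (LinearMap.ker f).subtype) ∘ₗ t = 0 :=
        LinearMap.pi_ext' fun j => LinearMap.ext_ring (congrFun hφ j)
      obtain ⟨a, ha⟩ := LinearMap.exists_comp_eq_of_surjective hf (q := φ) (fun x hx => by
        obtain ⟨y, hy⟩ := ht ⟨x, hx⟩
        have := LinearMap.congr_fun h0 y
        rw [LinearMap.comp_apply, hy] at this
        exact this)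
      exact ⟨a, ha⟩
  have : Module.Finite R (LinearMap.range L) := by
    rw [hLT]
    exact Module.Finite.iff_fg.2 (hR.fg_ker T)
  exact Module.Finite.equiv (LinearEquiv.ofInjective L hL).symm

/-- If every functional on a finitely generated module `G` factors through `ψ : G → F`, then so
does every homomorphism from `G` to a projective module. -/
theorem exists_comp_eq_of_dual {G F Q : Type u} [AddCommGroup G] [Module R G] [AddCommGroup F]
    [Module R F] [AddCommGroup Q] [Module R Q] [Module.Finite R G] [Module.Projective R Q]
    {ψ : G →ₗ[R] F} (hψ : ∀ φ : G →ₗ[R] R, ∃ φ' : F →ₗ[R] R, φ' ∘ₗ ψ = φ) (h : G →ₗ[R] Q) :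
    ∃ h' : F →ₗ[R] Q, h' ∘ₗ ψ = h := by
  classical
  obtain ⟨s, hs⟩ := (Module.projective_def (R := R) (P := Q)).1 inferInstance
  obtain ⟨T, hT⟩ := (inferInstance : Module.Finite R G).fg_top
  -- `s` embeds `Q` in a free module; as `G` is finitely generated, only the finitely many
  -- coordinates in `U` occur, and each is a functional that factors through `ψ`.
  let U : Finset Q := T.biUnion fun t => (s (h t)).support
  have hU (x : G) : (s (h x)).support ⊆ U := by
    have : (⊤ : Submodule R G) ≤ (Finsupp.supported R R (U : Set Q)).comap (s ∘ₗ h) := by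
      rw [← hT, Submodule.span_le]
      intro t ht
      change ((s (h t)).support : Set Q) ⊆ U
      exact_mod_cast Finset.subset_biUnion_of_mem (fun t => (s (h t)).support) ht
    exact_mod_cast this (Submodule.mem_top (x := x))
  choose φ' hφ' using fun q : Q => hψ (Finsupp.lapply q ∘ₗ s ∘ₗ h)
  refine ⟨∑ q ∈ U, (φ' q).smulRight q, LinearMap.ext fun x => ?_⟩
  have h1 (q : Q) : φ' q (ψ x) = s (h x) q := LinearMap.congr_fun (hφ' q) x
  have h2 := hs (h x)
  rw [Finsupp.linearCombination_apply, Finsupp.sum_of_support_subset _ (hU x) _ (by simp)] at h2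
  simpa [LinearMap.sum_apply, h1] using h2

/-- The coordinates of `ψ` are generators of the dual of `G`. Injectivity is not claimed; it
requires `G` to embed in a projective module. -/
theorem IsCoherentRing.exists_dual_embedding (hR : IsCoherentRing R) (G : Type u)
    [AddCommGroup G] [Module R G] [Module.FinitePresentation R G] :
    ∃ (k : ℕ) (ψ : G →ₗ[R] (Fin k → R)), ∀ φ : G →ₗ[R] R, ∃ φ' : (Fin k → R) →ₗ[R] R,
      φ' ∘ₗ ψ = φ := by
  have := hR.finite_dual G
  obtain ⟨k, π, hπ⟩ := Module.Finite.exists_fin' R (Module.Dual R G)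
  refine ⟨k, LinearMap.pi fun i => π (Pi.single i 1), fun φ => ?_⟩
  obtain ⟨c, rfl⟩ := hπ φ
  refine ⟨∑ i, c i • LinearMap.proj i, LinearMap.ext fun x => ?_⟩
  conv_rhs => rw [pi_eq_sum_univ' c]
  simp [LinearMap.sum_apply]

/-- Over a coherent ring, a Gorenstein projective module with a resolution by finitely generated
projectives embeds into a finitely generated projective module with a cokernel of the same kind. -/
theorem IsCoherentRing.exists_coresolution (hR : IsCoherentRing R) {G : ModuleCat.{u} R}
    (hG : IsGProj R G) (hG' : HasFGProjectiveResolution G) :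
    ∃ (F C : ModuleCat.{u} R) (f : G →ₗ[R] F) (g : F →ₗ[R] C), Module.Projective R F ∧
      Module.Finite R F ∧ IsSES f g ∧ IsGProj R C ∧ HasFGProjectiveResolution C := by
  have := hG'.finitePresentation
  obtain ⟨k, ψ, hψ⟩ := hR.exists_dual_embedding G
  obtain ⟨P, D, a, b, hP, hab, hD⟩ := hG.exists_right
  obtain ⟨a', ha'⟩ := exists_comp_eq_of_dual hψ a
  have hinj : Injective ψ := (injective_iff_map_eq_zero ψ).2 fun x hx => hab.eq_zero (by
    rw [← ha', LinearMap.comp_apply, hx, map_zero])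
  have hψC := isSES_coker hinj
  have hC : ExtProjVanish R ((Fin k → R) ⧸ LinearMap.range ψ) :=
    .of_projective_middle hψC fun Q hQ q => exists_comp_eq_of_dual hψ q
  -- The pushout `X` is Gorenstein projective as an extension of `D` by a free module. As an
  -- extension of the cokernel of `ψ` by `P` it splits, so that cokernel is the kernel of `X → P`.
  obtain ⟨X, i, j, i', j', h1, h2⟩ := hψC.exists_pushout hab
  obtain ⟨s, r, -, hsr⟩ := hC.exists_reverse h2
  refine ⟨ModuleCat.of R (Fin k → R), ModuleCat.of R ((Fin k → R) ⧸ LinearMap.range ψ), ψ,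
    (LinearMap.range ψ).mkQ, inferInstanceAs (Module.Projective R (Fin k → R)),
    inferInstanceAs (Module.Finite R (Fin k → R)), hψC,
    .of_ker hsr (.of_isSES h1 .of_projective hD) .of_projective, ?_⟩
  exact .of_isSES (P := ModuleCat.of R (Fin k → R)) hψC
    (inferInstanceAs (Module.Projective R (Fin k → R)))
    (inferInstanceAs (Module.Finite R (Fin k → R))) hG'

/-- Over a coherent ring, a module of finite Gorenstein projective dimension with a resolution by
finitely generated projectives embeds into one of finite projective dimension, with Gorenstein
projective cokernel. -/
theorem IsCoherentRing.exists_embedding_hasProjectiveDimensionLT (hR : IsCoherentRing R) {n : ℕ}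
    {M : ModuleCat.{u} R} (hM : HasFGProjectiveResolution M) (h : GProjDimLT (n + 1) M) :
    ∃ (N C : ModuleCat.{u} R) (f : M →ₗ[R] N) (g : N →ₗ[R] C), IsSES f g ∧
      HasFGProjectiveResolution N ∧ HasProjectiveDimensionLT N (n + 1) ∧
      IsGProj R C ∧ HasFGProjectiveResolution C := by
  induction n generalizing M with
  | zero =>
    obtain ⟨K, G, a, b, hab, hG, hK⟩ := h
    have : Subsingleton K := hK
    have hb : Injective b := (injective_iff_map_eq_zero b).2 fun x hx => by
      obtain ⟨y, rfl⟩ := hab.exists_eq hx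
      rw [Subsingleton.elim y 0, map_zero]
    have hMG := hG.of_equiv (LinearEquiv.ofBijective b ⟨hb, hab.surj⟩)
    obtain ⟨F, C, f, g, hF, hF', hfg, hC, hC'⟩ := hR.exists_coresolution hMG hM
    exact ⟨F, C, f, g, hfg, .of_projective hF hF', hasProjectiveDimensionLT_one_iff.2 hF, hC, hC'⟩
  | succ n ih =>
    obtain ⟨K, P, a, b, hab, hP, hP', hK⟩ := hM.exists_isSES
    obtain ⟨N', C', c, d, hcd, hN', hN'pd, hC', hC'F⟩ := ih hK (h.syzygy hab hP)
    -- `X` is an extension of `C'` by `P`, hence Gorenstein projective, and also an extension of `M`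
    -- by `N'`.
    obtain ⟨X, i, j, i', j', h1, h2⟩ := hab.exists_pushout hcd
    obtain ⟨F, C, f, g, hF, hF', hfg, hC, hCF⟩ := hR.exists_coresolution
      (.of_isSES h1 .of_projective hC') (.of_isSES_projective_left h1 hP hP' hC'F)
    -- `N = F / N'` contains `M = X / N'` with cokernel `F / X = C`, and `N'` is its first syzygy.
    obtain ⟨N, p, k, l, hp, hkl⟩ := h2.exists_coker_comp hfg
    exact ⟨N, C, k, l, hkl, .of_isSES hp hF hF' hN',
      (hp.hasProjectiveDimensionLT_iff hF).2 hN'pd, hC, hCF⟩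

end Coherent

theorem theorem2p9 (R : Type u) [CommRing R] (hR : IsCoherentRing R) : fGPD R = fPD R := by
  refine le_antisymm (sSup_le ?_) (sSup_le ?_)
  · rintro _ ⟨M, hM, hne, rfl⟩
    obtain ⟨n, hn⟩ := exists_gProjDimLT_of_ne_top hne
    -- The bound `n` may be 0, for a zero module, hence `hn.succ`. Any finite bound on pd N
    -- suffices, since only Gpd M ≤ Gpd N is used.
    obtain ⟨N, C, f, g, hfg, hN, hNpd, hC, -⟩ :=
      hR.exists_embedding_hasProjectiveDimensionLT hM hn.succ
    have hN' : projectiveDimension N ≠ ⊤ := (projectiveDimension_ne_top_iff N).2 ⟨n, hNpd⟩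
    refine (gorensteinProjectiveDimension_le_of_ker hfg hC).trans ?_
    rw [gorensteinProjectiveDimension_eq hN']
    exact le_sSup ⟨N, hN, hN', rfl⟩
  · rintro _ ⟨M, hM, hne, rfl⟩
    have := gorensteinProjectiveDimension_eq hne
    exact le_sSup ⟨M, hM, this ▸ hne, this.symm⟩
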